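/- Let $X_k(m)$, $k\in\{1,2,\dots\}$, $m\in\mathbb R_+$, be integrable real random variables on a probability space $(\Omega,\mathcal F,\mathbb P)$ that are independent in $k$, that is, the families $(X_k(m))_m$, $k=1,2,\dots$, are independent. Assume: (C) $\mathbb E[X_k(m)]=0$ for all $k$ and $m$. (S1) There is $\delta>0$ such that for every $\varepsilon>0$ there is a constant $C=C(\varepsilon)$ with $$\sup_k\mathbb P\big(|X_k(m)|>\varepsilon\big)<\frac{C}{m^{\delta}}\qquad\text{for all } m>0.$$ (S2) There are a random variable $X_*$ and $\gamma>0$ with $\mathbb E\big[|X_*|^{2+\gamma}\big]<\infty$ and $$\sup_{k,m}\mathbb P\big(X_k(m)>x\big)\le\mathbb P(X_*>x)\qquad\text{for all }x\in\mathbb R.$$ (S3) For every $\varepsilon>0$ there are $\beta>1$ and $C_\varepsilon>0$ such that for all $t,r,m>0$ $$\sup_k\mathbb P\Big(\sup_{0\le s\le m}\big|(r+s)X_k(r+s)-rX_k(r)\big|\ge t\varepsilon\Big)\le\frac{C_\varepsilon\,m^{\beta}}{t^{\beta}}.$$ Let $(m_k)_{k\ge1}$ be any sequence in $\mathbb R_+=[0,\infty)$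 with $\sum_k m_k=\infty$. Put $M_0=0$ and $M_n=\sum_{k=1}^n m_k$, and for $t>0$ let $\ell_t=\inf\{\ell\ge1: M_\ell\ge t\}$, $\bar t=t-M_{\ell_t-1}$ and $$\mathcal S_t=\sum_{k=1}^{\ell_t-1}\frac{m_k}{t}X_k(m_k)+\frac{\bar t}{t}X_{\ell_t}(\bar t).$$ Then $$\mathbb P\Big(\lim_{t\to\infty}\mathcal S_t=0\Big)=1.$$ -/

import Mathlib

open MeasureTheory ProbabilityTheory Filter Topology

namespace MassLLN

/-! Indices are shifted by one: the mathematical objects `m_k`, `X_k`, `k = 1, 2, …`, are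
`m (k - 1)`, `X (k - 1)` here. The value `X k m ω` matters only for `m > 0`. -/

/-- The total mass `M_n = m_1 + ⋯ + m_n` of the first `n` increments. -/
noncomputable def totalMass (m : ℕ → ℝ) (n : ℕ) : ℝ :=
  ∑ k ∈ Finset.range n, m k

/-- A mass sequence: nonnegative masses whose sum is infinite. -/
def IsDivergentMass (m : ℕ → ℝ) : Prop :=
  (∀ k, 0 ≤ m k) ∧ Tendsto (totalMass m) atTop atTop

/-- `ℓ_t = inf {ℓ ∈ {1, 2, …} : M_ℓ ≥ t}`. -/
noncomputable def lastIndex (m : ℕ → ℝ) (t : ℝ) : ℕ :=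
  sInf {l : ℕ | 1 ≤ l ∧ t ≤ totalMass m l}

/-- `t̄ = t - M_{ℓ_t - 1}`, the time spent in the current increment. -/
noncomputable def elapsed (m : ℕ → ℝ) (t : ℝ) : ℝ :=
  t - totalMass m (lastIndex m t - 1)

/-- The gradual sum `∑_{k=1}^{ℓ_t - 1} (m_k / t) X_k(m_k) + (t̄ / t) X_{ℓ_t}(t̄)`. -/
noncomputable def gradualSum {Ω : Type*} (X : ℕ → ℝ → Ω → ℝ) (m : ℕ → ℝ) (t : ℝ) (ω : Ω) : ℝ :=
  (∑ k ∈ Finset.range (lastIndex m t - 1), m k / t * X k (m k) ω)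
    + elapsed m t / t * X (lastIndex m t - 1) (elapsed m t) ω

/-- A family `X_k(m)` of integrable random variables that is independent in `k`: the processes
`(X_k(m))_{m > 0}`, `k = 1, 2, …`, are independent. -/
structure IsIndependentFamily {Ω : Type*} [MeasurableSpace Ω] (P : Measure Ω)
    (X : ℕ → ℝ → Ω → ℝ) : Prop where
  measurable : ∀ k : ℕ, ∀ m : ℝ, 0 < m → Measurable (X k m)
  integrable : ∀ k : ℕ, ∀ m : ℝ, 0 < m → Integrable (X k m) P
  indep : iIndepFun (fun (k : ℕ) (ω : Ω) (m : Set.Ioi (0 : ℝ)) => X k (m : ℝ) ω) P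

/-- Condition (C), centering. -/
def Centered {Ω : Type*} [MeasurableSpace Ω] (P : Measure Ω) (X : ℕ → ℝ → Ω → ℝ) : Prop :=
  ∀ k : ℕ, ∀ m : ℝ, 0 < m → ∫ ω, X k m ω ∂P = 0

/-- Condition (S1), polynomial decay. -/
def PolynomialDecay {Ω : Type*} [MeasurableSpace Ω] (P : Measure Ω) (X : ℕ → ℝ → Ω → ℝ) : Prop :=
  ∃ δ : ℝ, 0 < δ ∧ ∀ ε : ℝ, 0 < ε → ∃ C : ℝ, ∀ m : ℝ, 0 < m →
    (⨆ k : ℕ, P {ω | ε < |X k m ω|}) < ENNReal.ofReal (C / m ^ δ)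

/-- Condition (S2), stochastic domination and moment control. The dominating random variable
`X_*` enters only through its law `ν`, so it may live on any probability space. -/
def StochasticDomination {Ω : Type*} [MeasurableSpace Ω] (P : Measure Ω)
    (X : ℕ → ℝ → Ω → ℝ) : Prop :=
  ∃ (ν : Measure ℝ) (γ : ℝ), IsProbabilityMeasure ν ∧ 0 < γ ∧
    Integrable (fun x : ℝ => |x| ^ (2 + γ)) ν ∧
    ∀ x : ℝ, ∀ k : ℕ, ∀ m : ℝ, 0 < m → P {ω | x < X k m ω} ≤ ν (Set.Ioi x)

/-- Condition (S3), slow relative increment growth. The supremum over `s ∈ [0, m]` is taken in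
`[0, ∞]`; should the event fail to be measurable, its probability is the outer one. -/
def SlowIncrementGrowth {Ω : Type*} [MeasurableSpace Ω] (P : Measure Ω)
    (X : ℕ → ℝ → Ω → ℝ) : Prop :=
  ∀ ε : ℝ, 0 < ε → ∃ β C : ℝ, 1 < β ∧ 0 < C ∧ ∀ t r m : ℝ, 0 < t → 0 < r → 0 < m →
    (⨆ k : ℕ, P {ω | ENNReal.ofReal (t * ε) ≤
        ⨆ s ∈ Set.Icc (0 : ℝ) m, ‖(r + s) * X k (r + s) ω - r * X k r ω‖ₑ})
      ≤ ENNReal.ofReal (C * m ^ β / t ^ β)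

end MassLLN

/-! The completed increments are averaged as in a weighted strong law. By (S3) the averaged
variables have uniformly bounded moments of an order `r > 1`, and by (S1) the probability that
`|X_k(m_k)|` exceeds `ε` decays like a power of `m_k`. Hölder's inequality then makes
`(m_k / M_k) ^ p * E[|X_k(m_k)| ^ p; |X_k(m_k)| > ε]` summable for some `p > 1`, which gives an
almost surely convergent series and, by Kronecker's lemma, averages eventually of order `ε`.

The running increment, which starts at mass `M_{k-1}`, is small compared with `t` in two regimes.
While `t̄` is at most a constant times `M_{k-1} ^ α` with `α < 1`, the maximal inequality and
Borel–Cantelli along the sequence `M_{k-1}` suffice. Otherwise the increment contains a whole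
interval of the polynomial grid `j ^ (q + 1)`: (S1) controls the value at the grid point once `q` is
large, and (S3) the oscillation until the next one. -/

namespace MassLLN

section Deterministic

variable {m : ℕ → ℝ}

theorem totalMass_zero (m : ℕ → ℝ) : totalMass m 0 = 0 := rfl

theorem totalMass_succ (m : ℕ → ℝ) (n : ℕ) : totalMass m (n + 1) = totalMass m n + m n :=
  Finset.sum_range_succ m n

theorem IsDivergentMass.monotone (hm : IsDivergentMass m) : Monotone (totalMass m) :=
  monotone_nat_of_le_succ fun n => by rw [totalMass_succ]; linarith [hm.1 n]

theorem IsDivergentMass.totalMass_nonneg (hm : IsDivergentMass m) (n : ℕ) : 0 ≤ totalMass m n :=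
  Finset.sum_nonneg fun k _ => hm.1 k

theorem IsDivergentMass.le_totalMass_succ (hm : IsDivergentMass m) (k : ℕ) :
    m k ≤ totalMass m (k + 1) := by
  rw [totalMass_succ]
  linarith [hm.totalMass_nonneg k]

theorem IsDivergentMass.totalMass_succ_mul_div (hm : IsDivergentMass m) (k : ℕ) (a : ℝ) :
    totalMass m (k + 1) * (m k / totalMass m (k + 1) * a) = m k * a := by
  rcases eq_or_ne (totalMass m (k + 1)) 0 with h | h
  · have : m k = 0 := le_antisymm (h ▸ hm.le_totalMass_succ k) (hm.1 k)
    simp [this]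
  · rw [← mul_assoc, mul_div_cancel₀ _ h]

/-- The average of `a_1, …, a_n` with respect to the masses `m_1, …, m_n`. -/
noncomputable def massAverage (m a : ℕ → ℝ) (n : ℕ) : ℝ :=
  (∑ k ∈ Finset.range n, m k * a k) / totalMass m n

theorem massAverage_sub (m a b : ℕ → ℝ) (n : ℕ) :
    massAverage m (fun k => a k - b k) n = massAverage m a n - massAverage m b n := by
  simp only [massAverage, mul_sub, Finset.sum_sub_distrib, sub_div]

theorem IsDivergentMass.abs_massAverage_le (hm : IsDivergentMass m) {a : ℕ → ℝ} {c : ℝ}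
    (ha : ∀ k, |a k| ≤ c) (n : ℕ) : |massAverage m a n| ≤ c := by
  rw [massAverage, abs_div, abs_of_nonneg (hm.totalMass_nonneg n)]
  refine div_le_of_le_mul₀ (hm.totalMass_nonneg n) ((abs_nonneg _).trans (ha 0)) ?_
  calc |∑ k ∈ Finset.range n, m k * a k| ≤ ∑ k ∈ Finset.range n, |m k * a k| :=
        Finset.abs_sum_le_sum_abs _ _
    _ ≤ ∑ k ∈ Finset.range n, c * m k := Finset.sum_le_sum fun k _ => by
        rw [abs_mul, abs_of_nonneg (hm.1 k), mul_comm]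
        exact mul_le_mul_of_nonneg_right (ha k) (hm.1 k)
    _ = c * totalMass m n := (Finset.mul_sum _ _ _).symm

/-- **Kronecker's lemma**, for the weights `M_{k+1}`. -/
theorem IsDivergentMass.tendsto_massAverage_zero (hm : IsDivergentMass m) {a : ℕ → ℝ} {L : ℝ}
    (ha : Tendsto (fun n => ∑ k ∈ Finset.range n, m k / totalMass m (k + 1) * a k)
      atTop (𝓝 L)) :
    Tendsto (massAverage m a) atTop (𝓝 0) := by
  set R : ℕ → ℝ := fun n => L - ∑ k ∈ Finset.range n, m k / totalMass m (k + 1) * a k with hR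
  have hR0 : Tendsto R atTop (𝓝 0) := by simpa using ha.const_sub L
  have summation_by_parts : ∀ n, ∑ k ∈ Finset.range n, m k * a k
      = ∑ k ∈ Finset.range n, R k * m k - totalMass m n * R n := by
    intro n
    induction n with
    | zero => simp [totalMass_zero]
    | succ n ih =>
      have hstep : totalMass m (n + 1) * R (n + 1) = totalMass m (n + 1) * R n - m n * a n := by
        rw [← hm.totalMass_succ_mul_div n (a n)]
        simp only [hR, Finset.sum_range_succ]
        ring
      rw [Finset.sum_range_succ, ih, Finset.sum_range_succ, hstep, totalMass_succ]
      ring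
  have hlittle : (fun k => R k * m k) =o[atTop] m := by
    simpa using ((Asymptotics.isLittleO_one_iff ℝ).2 hR0).mul_isBigO
      (Asymptotics.isBigO_refl m atTop)
  have hlim := (hlittle.sum_range hm.1 hm.2).tendsto_div_nhds_zero.sub hR0
  rw [sub_zero] at hlim
  refine hlim.congr' ?_
  filter_upwards [hm.2.eventually_gt_atTop 0] with n hn
  rw [massAverage, summation_by_parts, sub_div, mul_div_cancel_left₀ _ hn.ne', totalMass]

theorem sub_div_rpow_one_add_le {x y η : ℝ} (hx : 0 < x) (hxy : x ≤ y) (hη : 0 < η) :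
    (y - x) / y ^ (1 + η) ≤ (x ^ (-η) - y ^ (-η)) / η := by
  have hy : 0 < y := hx.trans_le hxy
  have hz : 0 < x / y := div_pos hx hy
  have bernoulli : 1 + η * (1 - x / y) ≤ (x / y) ^ (-η) := by
    have hlog := Real.log_le_sub_one_of_pos hz
    have hexp := Real.add_one_le_exp (Real.log (x / y) * -η)
    rw [Real.rpow_def_of_pos hz]
    nlinarith
  have hxη : x ^ (-η) = y ^ (-η) * (x / y) ^ (-η) := by
    rw [← Real.mul_rpow hy.le hz.le, mul_div_cancel₀ _ hy.ne']
  have hyη : (y - x) / y ^ (1 + η) = y ^ (-η) * (1 - x / y) := by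
    rw [Real.rpow_add hy, Real.rpow_one, Real.rpow_neg hy.le]
    have := (Real.rpow_pos_of_pos hy η).ne'
    field_simp
  rw [hyη, hxη, le_div_iff₀ hη]
  nlinarith [mul_le_mul_of_nonneg_left bernoulli (Real.rpow_pos_of_pos hy (-η)).le]

theorem summable_sub_succ_of_antitone {u : ℕ → ℝ} (hu : Antitone u) (h0 : ∀ n, 0 ≤ u n) :
    Summable fun n => u n - u (n + 1) := by
  refine summable_of_sum_range_le (c := u 0) (fun n => sub_nonneg.2 (hu n.le_succ)) fun n => ?_
  rw [Finset.sum_range_sub']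
  linarith [h0 n]

theorem IsDivergentMass.summable_div_add_rpow (hm : IsDivergentMass m) {h : ℕ → ℝ}
    (h0 : ∀ k, 0 ≤ h k) (hle : ∀ k, h k ≤ m k) {η : ℝ} (hη : 0 < η) :
    Summable fun k => h k / (totalMass m k + h k) ^ (1 + η) := by
  obtain ⟨N, hN⟩ := eventually_atTop.1 (hm.2.eventually_gt_atTop 0)
  set u : ℕ → ℝ := fun n => totalMass m (n + N) ^ (-η) with hu
  have hanti : Antitone u := fun a b hab =>
    Real.rpow_le_rpow_of_nonpos (hN _ (by lia)) (hm.monotone (by lia)) (by linarith)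
  have htele := (summable_sub_succ_of_antitone hanti
    fun n => Real.rpow_nonneg (hm.totalMass_nonneg _) _).div_const η
  rw [← summable_nat_add_iff N]
  refine Summable.of_nonneg_of_le (fun n => ?_) (fun n => ?_) htele
  · have := hm.totalMass_nonneg (n + N)
    have := h0 (n + N)
    positivity
  · have hM : 0 < totalMass m (n + N) := hN _ (by lia)
    have hsucc : totalMass m (n + N) + h (n + N) ≤ totalMass m (n + 1 + N) := by
      rw [show n + 1 + N = n + N + 1 by ring, totalMass_succ]
      gcongr
      exact hle _
    have hstep := sub_div_rpow_one_add_le hM (le_add_of_nonneg_right (h0 (n + N))) hη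
    rw [add_sub_cancel_left] at hstep
    refine hstep.trans ?_
    gcongr
    exact Real.rpow_le_rpow_of_nonpos (by linarith [h0 (n + N)]) hsucc (by linarith)

theorem IsDivergentMass.summable_div_succ_rpow (hm : IsDivergentMass m) {η : ℝ} (hη : 0 < η) :
    Summable fun k => m k / totalMass m (k + 1) ^ (1 + η) := by
  simpa only [totalMass_succ] using hm.summable_div_add_rpow hm.1 (fun _ => le_rfl) hη

theorem IsDivergentMass.summable_div_rpow (hm : IsDivergentMass m) {h : ℕ → ℝ}
    (h0 : ∀ k, 0 ≤ h k) (hle : ∀ k, h k ≤ m k) {c : ℝ} (hc : 0 ≤ c)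
    (hh : ∀ᶠ k in atTop, h k ≤ c * totalMass m k) {η : ℝ} (hη : 0 < η) :
    Summable fun k => h k / totalMass m k ^ (1 + η) := by
  refine Summable.of_norm_bounded_eventually_nat
    ((hm.summable_div_add_rpow h0 hle hη).mul_left ((1 + c) ^ (1 + η))) ?_
  filter_upwards [hm.2.eventually_gt_atTop 0, hh] with k hM hck
  have hk := h0 k
  rw [Real.norm_of_nonneg (by positivity), mul_div_assoc', div_le_div_iff₀ (by positivity)
    (by positivity), mul_comm ((1 + c) ^ (1 + η)), mul_assoc, ← Real.mul_rpow (by linarith) hM.le]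
  gcongr
  linarith

theorem IsDivergentMass.le_totalMass_lastIndex (hm : IsDivergentMass m) (t : ℝ) :
    t ≤ totalMass m (lastIndex m t - 1 + 1) := by
  have hmem : lastIndex m t ∈ {l : ℕ | 1 ≤ l ∧ t ≤ totalMass m l} :=
    Nat.sInf_mem ((eventually_ge_atTop 1).and (hm.2.eventually_ge_atTop t)).exists
  rw [Nat.sub_add_cancel hmem.1]
  exact hmem.2

theorem totalMass_lastIndex_lt (m : ℕ → ℝ) {t : ℝ} (ht : 0 < t) :
    totalMass m (lastIndex m t - 1) < t := by
  by_contra! h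
  rcases Nat.eq_zero_or_pos (lastIndex m t - 1) with h0 | h0
  · rw [h0, totalMass_zero] at h
    linarith
  · have : lastIndex m t ≤ lastIndex m t - 1 := Nat.sInf_le ⟨h0, h⟩
    lia

theorem IsDivergentMass.elapsed_le (hm : IsDivergentMass m) (t : ℝ) :
    elapsed m t ≤ m (lastIndex m t - 1) := by
  have := hm.le_totalMass_lastIndex t
  rw [totalMass_succ] at this
  rw [elapsed]
  linarith

theorem IsDivergentMass.lastIndex_sub_one_eq (hm : IsDivergentMass m) {t : ℝ} (ht : 0 < t)
    {k : ℕ} (hlt : totalMass m k < t) (hle : t ≤ totalMass m (k + 1)) :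
    lastIndex m t - 1 = k := by
  have := hm.monotone.reflect_lt (hlt.trans_le (hm.le_totalMass_lastIndex t))
  have := hm.monotone.reflect_lt ((totalMass_lastIndex_lt m ht).trans_le hle)
  lia

theorem IsDivergentMass.tendsto_lastIndex_sub_one (hm : IsDivergentMass m) :
    Tendsto (fun t => lastIndex m t - 1) atTop atTop := by
  refine tendsto_atTop.2 fun N => ?_
  filter_upwards [eventually_gt_atTop (totalMass m N)] with t ht
  have := hm.monotone.reflect_lt (ht.trans_le (hm.le_totalMass_lastIndex t))
  lia

theorem IsDivergentMass.tendsto_completed_sum (hm : IsDivergentMass m) {a : ℕ → ℝ}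
    (ha : Tendsto (massAverage m a) atTop (𝓝 0)) :
    Tendsto (fun t => ∑ k ∈ Finset.range (lastIndex m t - 1), m k / t * a k) atTop (𝓝 0) := by
  have hlim := (ha.comp hm.tendsto_lastIndex_sub_one).norm
  rw [norm_zero] at hlim
  refine squeeze_zero_norm' ?_ hlim
  filter_upwards [eventually_gt_atTop 0,
    (hm.2.comp hm.tendsto_lastIndex_sub_one).eventually_gt_atTop 0] with t ht0 hM0
  simp only [Function.comp_apply] at hM0
  simp only [Function.comp_apply, massAverage, div_mul_eq_mul_div, ← Finset.sum_div, norm_div]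
  rw [Real.norm_of_nonneg ht0.le, Real.norm_of_nonneg hM0.le]
  exact div_le_div_of_nonneg_left (norm_nonneg _) hM0 (totalMass_lastIndex_lt m ht0).le

theorem rpow_mul_rpow_le_one_add {m q δ θ η D : ℝ} (hm : 0 ≤ m) (hq0 : 0 ≤ q) (hq1 : q ≤ 1)
    (hθ : 0 ≤ θ) (hη : 0 ≤ η) (hηδ : η ≤ δ * θ) (hD : q * m ^ δ ≤ D) :
    m ^ η * q ^ θ ≤ 1 + D ^ θ := by
  have hD0 : 0 ≤ D := (by positivity : 0 ≤ q * m ^ δ).trans hD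
  rcases le_total m 1 with h | h
  · have := mul_le_one₀ (Real.rpow_le_one hm h hη) (Real.rpow_nonneg hq0 θ)
      (Real.rpow_le_one hq0 hq1 hθ)
    linarith [Real.rpow_nonneg hD0 θ]
  · calc m ^ η * q ^ θ ≤ m ^ (δ * θ) * q ^ θ := by gcongr
      _ = (q * m ^ δ) ^ θ := by rw [Real.rpow_mul hm, mul_comm, Real.mul_rpow hq0 (by positivity)]
      _ ≤ D ^ θ := Real.rpow_le_rpow (by positivity) hD hθ
      _ ≤ 1 + D ^ θ := by linarith

theorem div_rpow_mul_le {m M p η b c : ℝ} (hm : 0 ≤ m) (hmM : m ≤ M) (hη : 0 ≤ η)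
    (hηp : η ≤ p - 1) (hb : m ^ η * b ≤ c) (hb0 : 0 ≤ b) :
    (m / M) ^ p * b ≤ c * (m / M ^ (1 + η)) := by
  rcases hm.eq_or_lt with rfl | hm
  · rw [zero_div, zero_div, mul_zero, Real.zero_rpow (by linarith), zero_mul]
  have hM : 0 < M := hm.trans_le hmM
  have hsplit : ∀ x : ℝ, 0 < x → x ^ p = x ^ (1 + η) * x ^ (p - 1 - η) := fun x hx => by
    rw [← Real.rpow_add hx]
    ring_nf
  calc (m / M) ^ p * b = (m / M) ^ (1 + η) * (m / M) ^ (p - 1 - η) * b := by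
        rw [hsplit _ (div_pos hm hM)]
    _ ≤ (m / M) ^ (1 + η) * 1 * b := by
        gcongr
        exact Real.rpow_le_one (by positivity) ((div_le_one hM).2 hmM) (by linarith)
    _ = m ^ η * b * (m / M ^ (1 + η)) := by
        rw [Real.div_rpow hm.le hM.le, Real.rpow_add hm, Real.rpow_one]
        ring
    _ ≤ c * (m / M ^ (1 + η)) := by gcongr

end Deterministic

section RandomSeries

variable {Ω : Type*} [MeasurableSpace Ω] {P : Measure Ω}

theorem ae_summable_of_summable_integral_abs {B : ℕ → Ω → ℝ} (hB : ∀ k, Integrable (B k) P)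
    (hsum : Summable fun k => ∫ ω, |B k ω| ∂P) : ∀ᵐ ω ∂P, Summable fun k => B k ω := by
  have hfin : ∫⁻ ω, ∑' k, ‖B k ω‖ₑ ∂P ≠ ⊤ := by
    rw [lintegral_tsum fun k => (hB k).1.enorm]
    simpa only [← ofReal_integral_norm_eq_lintegral_enorm (hB _), Real.norm_eq_abs]
      using hsum.tsum_ofReal_ne_top
  filter_upwards [ae_lt_top' (.tsum fun k => (hB k).1.enorm) hfin] with ω hω
  exact Summable.of_enorm hω.ne

theorem ae_exists_tendsto_sum_sub_integral_of_abs {B : ℕ → Ω → ℝ}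
    (hB : ∀ k, Integrable (B k) P) (hsum : Summable fun k => ∫ ω, |B k ω| ∂P) :
    ∀ᵐ ω ∂P, ∃ L, Tendsto
      (fun n => ∑ k ∈ Finset.range n, (B k ω - ∫ ω, B k ω ∂P)) atTop (𝓝 L) := by
  have hmean : Summable fun k => ∫ ω, B k ω ∂P :=
    Summable.of_norm_bounded hsum fun k => abs_integral_le_integral_abs
  filter_upwards [ae_summable_of_summable_integral_abs hB hsum] with ω hω
  exact ⟨_, (hω.sub hmean).hasSum.tendsto_sum_nat⟩

variable [IsProbabilityMeasure P]

theorem ae_exists_tendsto_sum_of_integral_abs_le {W : ℕ → Ω → ℝ}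
    (hmeas : ∀ k, Measurable (W k)) (hind : iIndepFun W P) (hint : ∀ k, Integrable (W k) P)
    (hcent : ∀ k, ∫ ω, W k ω ∂P = 0) {K : ℝ}
    (hK : ∀ n, ∫ ω, |∑ k ∈ Finset.range n, W k ω| ∂P ≤ K) :
    ∀ᵐ ω ∂P, ∃ L, Tendsto (fun n => ∑ k ∈ Finset.range n, W k ω) atTop (𝓝 L) := by
  have hsm : ∀ k, StronglyMeasurable (W k) := fun k => (hmeas k).stronglyMeasurable
  let 𝒢 := Filtration.natural W hsm
  let f : ℕ → Ω → ℝ := fun n ω => ∑ k ∈ Finset.range (n + 1), W k ω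
  have hfint : ∀ n, Integrable (f n) P := fun n => integrable_finsetSum _ fun k _ => hint k
  have hadp : StronglyAdapted 𝒢 f := fun n =>
    Finset.stronglyMeasurable_fun_sum _ fun k hk =>
      (Filtration.stronglyAdapted_natural hsm k).mono
        (𝒢.mono (Nat.lt_succ_iff.1 (Finset.mem_range.1 hk)))
  have hmart : Martingale f 𝒢 P := by
    refine martingale_of_condExp_sub_eq_zero_nat hadp hfint fun i => ?_
    have hstep : f (i + 1) - f i = W (i + 1) := by
      ext ω
      simp only [f, Pi.sub_apply, Finset.sum_range_succ _ (i + 1), add_sub_cancel_left]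
    rw [hstep]
    refine (hind.condExp_natural_ae_eq_of_lt hsm (Nat.lt_succ_self i)).trans ?_
    rw [hcent]
    rfl
  have hbdd : ∀ n, eLpNorm (f n) 1 P ≤ (K.toNNReal : ENNReal) := fun n => by
    rw [eLpNorm_one_eq_lintegral_enorm, ← ofReal_integral_norm_eq_lintegral_enorm (hfint n)]
    exact ENNReal.ofReal_le_ofReal (hK (n + 1))
  filter_upwards [hmart.submartingale.ae_tendsto_limitProcess hbdd] with ω hω
  exact ⟨_, (tendsto_add_atTop_iff_nat 1).1 hω⟩

theorem integral_abs_sum_sub_integral_le {A : ℕ → Ω → ℝ} (hind : iIndepFun A P)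
    (hA : ∀ k, MemLp (A k) 2 P) (n : ℕ) :
    ∫ ω, |∑ k ∈ Finset.range n, (A k ω - ∫ ω, A k ω ∂P)| ∂P
      ≤ 1 + ∑ k ∈ Finset.range n, ∫ ω, A k ω ^ 2 ∂P := by
  set S : Ω → ℝ := ∑ k ∈ Finset.range n, A k with hS
  have hSL : MemLp S 2 P := memLp_finsetSum' _ fun k _ => hA k
  have hD : MemLp (fun ω => S ω - ∫ ω, S ω ∂P) 2 P := hSL.sub (memLp_const _)
  have hsub : ∀ ω, ∑ k ∈ Finset.range n, (A k ω - ∫ ω, A k ω ∂P) = S ω - ∫ ω, S ω ∂P := fun ω => by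
    simp only [hS, Finset.sum_apply, Finset.sum_sub_distrib]
    rw [integral_finsetSum _ fun k _ => (hA k).integrable one_le_two]
  have hvar : ∫ ω, (S ω - ∫ ω, S ω ∂P) ^ 2 ∂P ≤ ∑ k ∈ Finset.range n, ∫ ω, A k ω ^ 2 ∂P := by
    rw [← variance_eq_integral hSL.aestronglyMeasurable.aemeasurable, hS,
      IndepFun.variance_sum (fun k _ => hA k) fun i _ j _ hij => hind.indepFun hij]
    exact Finset.sum_le_sum fun k _ => variance_le_expectation_sq (hA k).aestronglyMeasurable
  simp_rw [hsub]
  calc ∫ ω, |S ω - ∫ ω, S ω ∂P| ∂P ≤ ∫ ω, (1 + (S ω - ∫ ω, S ω ∂P) ^ 2) ∂P := by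
        refine integral_mono (hD.integrable one_le_two).abs
          ((integrable_const _).add hD.integrable_sq) fun ω => ?_
        simp only
        nlinarith [sq_abs (S ω - ∫ ω, S ω ∂P), sq_nonneg (|S ω - ∫ ω, S ω ∂P| - 1)]
    _ ≤ 1 + ∑ k ∈ Finset.range n, ∫ ω, A k ω ^ 2 ∂P := by
        rw [integral_add (integrable_const _) hD.integrable_sq]
        simpa using hvar

theorem ae_exists_tendsto_sum_sub_integral_of_sq {A : ℕ → Ω → ℝ} (hmeas : ∀ k, Measurable (A k))
    (hind : iIndepFun A P) (hA : ∀ k, MemLp (A k) 2 P)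
    (hsum : Summable fun k => ∫ ω, A k ω ^ 2 ∂P) :
    ∀ᵐ ω ∂P, ∃ L, Tendsto
      (fun n => ∑ k ∈ Finset.range n, (A k ω - ∫ ω, A k ω ∂P)) atTop (𝓝 L) := by
  have hAi : ∀ k, Integrable (A k) P := fun k => (hA k).integrable one_le_two
  refine ae_exists_tendsto_sum_of_integral_abs_le (W := fun k ω => A k ω - ∫ ω, A k ω ∂P)
    (K := 1 + ∑' k, ∫ ω, A k ω ^ 2 ∂P) (fun k => (hmeas k).sub_const _)
    (hind.comp (fun k x => x - ∫ ω, A k ω ∂P) fun k => measurable_id.sub_const _)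
    (fun k => (hAi k).sub (integrable_const _)) (fun k => ?_) fun n => ?_
  · simp [integral_sub (hAi k) (integrable_const _)]
  · refine (integral_abs_sum_sub_integral_le hind hA n).trans ?_
    gcongr
    exact hsum.sum_le_tsum _ fun k _ => integral_nonneg fun ω => sq_nonneg _

/-- The part of a real number beyond the truncation level `c`: `tailPart c y` is `y` when
`c < |y|` and `0` otherwise. -/
noncomputable def tailPart (c : ℝ) : ℝ → ℝ := {y | c < |y|}.indicator id

theorem measurable_tailPart (c : ℝ) : Measurable (tailPart c) :=
  measurable_id.indicator (measurableSet_lt measurable_const measurable_norm)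

theorem abs_tailPart_le_abs (c y : ℝ) : |tailPart c y| ≤ |y| :=
  norm_indicator_le_norm_self id y

theorem abs_sub_tailPart_le {c : ℝ} (hc : 0 ≤ c) (y : ℝ) : |y - tailPart c y| ≤ c := by
  by_cases h : c < |y|
  · simpa [tailPart, h] using hc
  · simpa [tailPart, h] using not_lt.1 h

theorem abs_tailPart_one_le_rpow {p : ℝ} (hp : 1 ≤ p) (y : ℝ) : |tailPart 1 y| ≤ |y| ^ p := by
  by_cases h : 1 < |y|
  · simpa [tailPart, h] using Real.self_le_rpow_of_one_le h.le hp
  · simpa [tailPart, h] using Real.rpow_nonneg (abs_nonneg y) p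

theorem sq_sub_tailPart_one_le_rpow {p : ℝ} (hp : p ≤ 2) (y : ℝ) :
    (y - tailPart 1 y) ^ 2 ≤ |y| ^ p := by
  have hyp := Real.rpow_nonneg (abs_nonneg y) p
  by_cases h : 1 < |y|
  · simpa [tailPart, h] using hyp
  · rcases eq_or_ne y 0 with rfl | hy
    · simpa [tailPart] using hyp
    · have := Real.rpow_le_rpow_of_exponent_ge (abs_pos.2 hy) (not_lt.1 h) hp
      simpa [tailPart, h] using this

theorem ae_exists_tendsto_sum_sub_integral {V : ℕ → Ω → ℝ} {p : ℝ} (hp1 : 1 ≤ p) (hp2 : p ≤ 2)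
    (hmeas : ∀ k, Measurable (V k)) (hind : iIndepFun V P)
    (hVp : ∀ k, Integrable (fun ω => |V k ω| ^ p) P)
    (hsum : Summable fun k => ∫ ω, |V k ω| ^ p ∂P) :
    ∀ᵐ ω ∂P, ∃ L, Tendsto
      (fun n => ∑ k ∈ Finset.range n, (V k ω - ∫ ω, V k ω ∂P)) atTop (𝓝 L) := by
  let A : ℕ → Ω → ℝ := fun k ω => V k ω - tailPart 1 (V k ω)
  let B : ℕ → Ω → ℝ := fun k ω => tailPart 1 (V k ω)
  have hhead : Measurable fun y => y - tailPart 1 y := measurable_id.sub (measurable_tailPart 1)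
  have hAm : ∀ k, Measurable (A k) := fun k => hhead.comp (hmeas k)
  have hA : ∀ k, MemLp (A k) 2 P := fun k => MemLp.of_bound (hAm k).aestronglyMeasurable 1
    (ae_of_all _ fun ω => abs_sub_tailPart_le zero_le_one _)
  have hB : ∀ k, Integrable (B k) P := fun k => (hVp k).mono'
    ((measurable_tailPart 1).comp (hmeas k)).aestronglyMeasurable
    (ae_of_all _ fun ω => abs_tailPart_one_le_rpow hp1 _)
  have hsumA : Summable fun k => ∫ ω, A k ω ^ 2 ∂P :=
    hsum.of_nonneg_of_le (fun k => integral_nonneg fun ω => sq_nonneg _) fun k =>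
      integral_mono (hA k).integrable_sq (hVp k) fun ω => sq_sub_tailPart_one_le_rpow hp2 _
  have hsumB : Summable fun k => ∫ ω, |B k ω| ∂P :=
    hsum.of_nonneg_of_le (fun k => integral_nonneg fun ω => abs_nonneg _) fun k =>
      integral_mono (hB k).abs (hVp k) fun ω => abs_tailPart_one_le_rpow hp1 _
  have hmean : ∀ k, ∫ ω, V k ω ∂P = ∫ ω, A k ω ∂P + ∫ ω, B k ω ∂P := fun k => by
    rw [← integral_add ((hA k).integrable one_le_two) (hB k)]
    simp only [A, B, sub_add_cancel]
  filter_upwards [ae_exists_tendsto_sum_sub_integral_of_sq hAm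
      (hind.comp (fun _ y => y - tailPart 1 y) fun _ => hhead) hA hsumA,
    ae_exists_tendsto_sum_sub_integral_of_abs hB hsumB] with ω ⟨a, ha⟩ ⟨b, hb⟩
  refine ⟨a + b, (ha.add hb).congr fun n => ?_⟩
  rw [← Finset.sum_add_distrib]
  refine Finset.sum_congr rfl fun k _ => ?_
  rw [hmean]
  ring

end RandomSeries

section Moments

variable {Ω : Type*} [MeasurableSpace Ω] {P : Measure Ω}

theorem setIntegral_abs_rpow_le [IsFiniteMeasure P] {Y : Ω → ℝ} {p r : ℝ} (hp : 0 < p) (hpr : p < r)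
    (hY : AEStronglyMeasurable Y P) (hYr : Integrable (fun ω => |Y ω| ^ r) P) (S : Set Ω) :
    ∫ ω in S, |Y ω| ^ p ∂P ≤ (∫ ω, |Y ω| ^ r ∂P) ^ (p / r) * P.real S ^ (1 - p / r) := by
  have hr : 0 < r := hp.trans hpr
  have hconj := Real.HolderConjugate.conjExponent ((one_lt_div hp).2 hpr)
  have hinv : 1 / Real.conjExponent (r / p) = 1 - p / r := by
    have := hconj.inv_add_inv_eq_one
    rw [inv_div] at this
    rw [one_div]
    linarith
  have hpow : ∀ ω, (|Y ω| ^ p) ^ (r / p) = |Y ω| ^ r := fun ω => by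
    rw [← Real.rpow_mul (abs_nonneg _), mul_div_cancel₀ _ hp.ne']
  have hL : MemLp (fun ω => |Y ω| ^ p) (ENNReal.ofReal (r / p)) (P.restrict S) := by
    have hne : ENNReal.ofReal (r / p) ≠ 0 := (ENNReal.ofReal_pos.2 (by positivity)).ne'
    refine MemLp.restrict S ((integrable_norm_rpow_iff
      (hY.aemeasurable.abs.pow_const p).aestronglyMeasurable hne ENNReal.ofReal_ne_top).1 ?_)
    refine hYr.congr (ae_of_all _ fun ω => ?_)
    simp only [ENNReal.toReal_ofReal (by positivity : 0 ≤ r / p)]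
    rw [Real.norm_of_nonneg (by positivity), hpow]
  have hölder := integral_mul_le_Lp_mul_Lq_of_nonneg hconj (g := fun _ => (1 : ℝ))
    (ae_of_all _ fun ω => by positivity) (ae_of_all _ fun _ => zero_le_one) hL (memLp_const 1)
  simp only [mul_one, hpow, Real.one_rpow, hinv, one_div_div, integral_const, smul_eq_mul,
    measureReal_restrict_apply_univ] at hölder
  refine hölder.trans (mul_le_mul_of_nonneg_right ?_ (by positivity))
  exact Real.rpow_le_rpow (integral_nonneg fun ω => by positivity)
    (setIntegral_le_integral hYr (ae_of_all _ fun ω => by positivity)) (by positivity)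

theorem integral_abs_tailPart_rpow_le [IsFiniteMeasure P] {Y : Ω → ℝ} {p r : ℝ} (hp : 0 < p)
    (hpr : p < r) (hY : Measurable Y) (hYr : Integrable (fun ω => |Y ω| ^ r) P) (c : ℝ) :
    ∫ ω, |tailPart c (Y ω)| ^ p ∂P
      ≤ (∫ ω, |Y ω| ^ r ∂P) ^ (p / r) * P.real {ω | c < |Y ω|} ^ (1 - p / r) := by
  have hS : MeasurableSet {ω | c < |Y ω|} := measurableSet_lt measurable_const hY.abs
  have hpow : ∀ ω, |tailPart c (Y ω)| ^ p
      = {ω | c < |Y ω|}.indicator (fun ω => |Y ω| ^ p) ω := fun ω => by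
    by_cases h : c < |Y ω|
    · simp [tailPart, h]
    · simp [tailPart, h, Real.zero_rpow hp.ne']
  simp_rw [hpow]
  rw [integral_indicator hS]
  exact setIntegral_abs_rpow_le hp hpr hY.aestronglyMeasurable hYr _

theorem lintegral_Ioc_zero_one_rpow {r : ℝ} (hr : 0 < r) :
    ∫⁻ x in Set.Ioc (0 : ℝ) 1, ENNReal.ofReal (x ^ (r - 1)) = ENNReal.ofReal (1 / r) := by
  have hint : IntegrableOn (fun x : ℝ => x ^ (r - 1)) (Set.Ioc 0 1) :=
    (intervalIntegrable_iff_integrableOn_Ioc_of_le zero_le_one).1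
      (intervalIntegral.intervalIntegrable_rpow' (by linarith))
  rw [← ofReal_integral_eq_lintegral_ofReal hint
    (ae_restrict_of_forall_mem measurableSet_Ioc fun x hx => Real.rpow_nonneg hx.1.le _),
    ← intervalIntegral.integral_of_le zero_le_one, integral_rpow (Or.inl (by linarith))]
  simp [hr.ne']

theorem lintegral_Ioi_one_div_rpow_mul_rpow {r β C : ℝ} (hrβ : r < β) (hC : 0 ≤ C) :
    ∫⁻ x in Set.Ioi (1 : ℝ), ENNReal.ofReal (C / x ^ β) * ENNReal.ofReal (x ^ (r - 1))
      = ENNReal.ofReal (C / (β - r)) := by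
  have hpow : ∀ x ∈ Set.Ioi (1 : ℝ), ENNReal.ofReal (C / x ^ β) * ENNReal.ofReal (x ^ (r - 1))
      = ENNReal.ofReal (C * x ^ (r - 1 - β)) := fun x hx => by
    have hx0 : (0 : ℝ) < x := zero_lt_one.trans hx
    rw [← ENNReal.ofReal_mul (by positivity), Real.rpow_sub hx0 _ β, div_mul_eq_mul_div,
      mul_div_assoc]
  have hint := (integrableOn_Ioi_rpow_of_lt (by linarith : r - 1 - β < -1) one_pos).const_mul C
  rw [setLIntegral_congr_fun measurableSet_Ioi hpow, ← ofReal_integral_eq_lintegral_ofReal hint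
    (ae_restrict_of_forall_mem measurableSet_Ioi fun x hx =>
      mul_nonneg hC (Real.rpow_nonneg (zero_lt_one.trans hx).le _)),
    integral_const_mul, integral_Ioi_rpow_of_lt (by linarith) one_pos, Real.one_rpow,
    show r - 1 - β + 1 = -(β - r) by ring, neg_div_neg_eq, mul_one_div]

variable [IsProbabilityMeasure P]

theorem lintegral_abs_rpow_le_of_tail {Y : Ω → ℝ} {r β C : ℝ} (hY : AEMeasurable Y P)
    (hr : 0 < r) (hrβ : r < β) (hC : 0 ≤ C)
    (htail : ∀ x : ℝ, 0 < x → P.real {ω | x ≤ |Y ω|} ≤ C / x ^ β) :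
    ∫⁻ ω, ENNReal.ofReal (|Y ω| ^ r) ∂P ≤ ENNReal.ofReal (1 + r * (C / (β - r))) := by
  have hlow : ∀ x : ℝ, P {ω | x ≤ |Y ω|} * ENNReal.ofReal (x ^ (r - 1))
      ≤ ENNReal.ofReal (x ^ (r - 1)) := fun x => mul_le_of_le_one_left' prob_le_one
  have hhigh : ∀ x ∈ Set.Ioi (1 : ℝ), P {ω | x ≤ |Y ω|} * ENNReal.ofReal (x ^ (r - 1))
      ≤ ENNReal.ofReal (C / x ^ β) * ENNReal.ofReal (x ^ (r - 1)) := fun x hx => by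
    gcongr
    rw [← ofReal_measureReal]
    exact ENNReal.ofReal_le_ofReal (htail x (zero_lt_one.trans hx))
  have hβr : 0 < β - r := sub_pos.2 hrβ
  rw [lintegral_rpow_eq_lintegral_meas_le_mul P (ae_of_all _ fun ω => abs_nonneg _) hY.abs hr,
    ← Set.Ioc_union_Ioi_eq_Ioi zero_le_one,
    lintegral_union measurableSet_Ioi (Set.Ioc_disjoint_Ioi le_rfl)]
  calc ENNReal.ofReal r * (_ + _)
      ≤ ENNReal.ofReal r * (ENNReal.ofReal (1 / r) + ENNReal.ofReal (C / (β - r))) := by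
        rw [← lintegral_Ioc_zero_one_rpow hr, ← lintegral_Ioi_one_div_rpow_mul_rpow hrβ hC]
        gcongr ENNReal.ofReal r * (?_ + ?_)
        · exact lintegral_mono hlow
        · exact setLIntegral_mono' measurableSet_Ioi hhigh
    _ = ENNReal.ofReal (1 + r * (C / (β - r))) := by
        rw [← ENNReal.ofReal_add (by positivity) (by positivity), ← ENNReal.ofReal_mul hr.le,
          mul_add, mul_one_div_cancel hr.ne']

theorem integrable_abs_rpow_of_tail {Y : Ω → ℝ} {r β C : ℝ} (hY : AEMeasurable Y P)
    (hr : 0 < r) (hrβ : r < β) (hC : 0 ≤ C)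
    (htail : ∀ x : ℝ, 0 < x → P.real {ω | x ≤ |Y ω|} ≤ C / x ^ β) :
    Integrable (fun ω => |Y ω| ^ r) P := by
  refine ⟨(hY.abs.pow_const r).aestronglyMeasurable, ?_⟩
  rw [hasFiniteIntegral_iff_ofReal (ae_of_all _ fun ω => by positivity)]
  exact (lintegral_abs_rpow_le_of_tail hY hr hrβ hC htail).trans_lt ENNReal.ofReal_lt_top

theorem integral_abs_rpow_le_of_tail {Y : Ω → ℝ} {r β C : ℝ} (hY : AEMeasurable Y P)
    (hr : 0 < r) (hrβ : r < β) (hC : 0 ≤ C)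
    (htail : ∀ x : ℝ, 0 < x → P.real {ω | x ≤ |Y ω|} ≤ C / x ^ β) :
    ∫ ω, |Y ω| ^ r ∂P ≤ 1 + r * (C / (β - r)) := by
  have hβr : 0 < β - r := sub_pos.2 hrβ
  rw [integral_eq_lintegral_of_nonneg_ae (ae_of_all _ fun ω => by positivity)
    (hY.abs.pow_const r).aestronglyMeasurable]
  exact ENNReal.toReal_le_of_le_ofReal (by positivity)
    (lintegral_abs_rpow_le_of_tail hY hr hrβ hC htail)

end Moments

section WeightedAverages

variable {Ω : Type*} [MeasurableSpace Ω] {P : Measure Ω} {m : ℕ → ℝ}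

theorem ae_tendsto_zero_of_ae_eventually_abs_le {ι : Type*} {l : Filter ι} {f : ι → Ω → ℝ}
    (h : ∀ ε > 0, ∀ᵐ ω ∂P, ∀ᶠ i in l, |f i ω| ≤ ε) :
    ∀ᵐ ω ∂P, Tendsto (fun i => f i ω) l (𝓝 0) := by
  have hall : ∀ᵐ ω ∂P, ∀ n : ℕ, ∀ᶠ i in l, |f i ω| ≤ 1 / ((n : ℝ) + 1) :=
    ae_all_iff.2 fun n => h _ Nat.one_div_pos_of_nat
  filter_upwards [hall] with ω hω
  refine Metric.tendsto_nhds.2 fun ε hε => ?_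
  obtain ⟨n, hn⟩ := exists_nat_one_div_lt hε
  filter_upwards [hω n] with i hi
  rw [Real.dist_0_eq_abs]
  exact hi.trans_lt hn

variable [IsProbabilityMeasure P]

theorem IsDivergentMass.ae_tendsto_massAverage_sub_integral (hm : IsDivergentMass m)
    {U : ℕ → Ω → ℝ} {p : ℝ} (hp1 : 1 ≤ p) (hp2 : p ≤ 2) (hmeas : ∀ k, Measurable (U k))
    (hind : iIndepFun U P) (hUp : ∀ k, Integrable (fun ω => |U k ω| ^ p) P)
    (hsum : Summable fun k => (m k / totalMass m (k + 1)) ^ p * ∫ ω, |U k ω| ^ p ∂P) :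
    ∀ᵐ ω ∂P, Tendsto (massAverage m fun k => U k ω - ∫ ω, U k ω ∂P) atTop (𝓝 0) := by
  let w : ℕ → ℝ := fun k => m k / totalMass m (k + 1)
  have hw : ∀ k, 0 ≤ w k := fun k => div_nonneg (hm.1 k) (hm.totalMass_nonneg _)
  have hpow : ∀ k ω, |w k * U k ω| ^ p = w k ^ p * |U k ω| ^ p := fun k ω => by
    rw [abs_mul, abs_of_nonneg (hw k), Real.mul_rpow (hw k) (abs_nonneg _)]
  have hseries := ae_exists_tendsto_sum_sub_integral (V := fun k ω => w k * U k ω) hp1 hp2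
    (fun k => (hmeas k).const_mul _)
    (hind.comp (fun k y => w k * y) fun k => measurable_id.const_mul _)
    (fun k => by simpa only [hpow] using (hUp k).const_mul _)
    (by simpa only [hpow, integral_const_mul] using hsum)
  filter_upwards [hseries] with ω ⟨L, hL⟩
  refine hm.tendsto_massAverage_zero (hL.congr fun n => Finset.sum_congr rfl fun k _ => ?_)
  rw [integral_const_mul, ← mul_sub]

theorem IsDivergentMass.ae_tendsto_massAverage_of_summable_tailPart (hm : IsDivergentMass m)
    {Y : ℕ → Ω → ℝ} {p : ℝ} (hp1 : 1 ≤ p) (hp2 : p ≤ 2) (hmeas : ∀ k, Measurable (Y k))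
    (hind : iIndepFun Y P) (hint : ∀ k, Integrable (Y k) P) (hcent : ∀ k, ∫ ω, Y k ω ∂P = 0)
    (hYp : ∀ k, Integrable (fun ω => |Y k ω| ^ p) P)
    (hsum : ∀ ε > 0, Summable fun k =>
      (m k / totalMass m (k + 1)) ^ p * ∫ ω, |tailPart ε (Y k ω)| ^ p ∂P) :
    ∀ᵐ ω ∂P, Tendsto (massAverage m fun k => Y k ω) atTop (𝓝 0) := by
  refine ae_tendsto_zero_of_ae_eventually_abs_le (f := fun n ω => massAverage m (Y · ω) n)
    fun ε hε => ?_
  have hε3 : 0 < ε / 3 := by positivity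
  let U : ℕ → Ω → ℝ := fun k ω => tailPart (ε / 3) (Y k ω)
  have hUm : ∀ k, Measurable (U k) := fun k => (measurable_tailPart _).comp (hmeas k)
  have hUi : ∀ k, Integrable (U k) P := fun k => (hint k).mono (hUm k).aestronglyMeasurable
    (ae_of_all _ fun ω => abs_tailPart_le_abs _ _)
  have hUp : ∀ k, Integrable (fun ω => |U k ω| ^ p) P := fun k =>
    (hYp k).mono' ((hUm k).abs.pow_const p).aestronglyMeasurable (ae_of_all _ fun ω => by
      rw [Real.norm_of_nonneg (by positivity)]
      exact Real.rpow_le_rpow (abs_nonneg _) (abs_tailPart_le_abs _ _) (by linarith))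
  have hmean : ∀ k, |∫ ω, U k ω ∂P| ≤ ε / 3 := fun k => by
    have hbound := norm_integral_le_of_norm_le_const (μ := P) (f := fun ω => Y k ω - U k ω)
      (ae_of_all _ fun ω => abs_sub_tailPart_le hε3.le (Y k ω))
    rw [integral_sub (hint k) (hUi k), hcent, zero_sub, norm_neg] at hbound
    simpa using hbound
  filter_upwards [hm.ae_tendsto_massAverage_sub_integral hp1 hp2 hUm
    (hind.comp (fun _ => tailPart (ε / 3)) fun _ => measurable_tailPart _) hUp
    (hsum _ hε3)] with ω hω
  have hsmall := hω.abs.eventually_le_const (show |(0 : ℝ)| < ε / 3 by simpa using hε3)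
  filter_upwards [hsmall] with n hn
  have hrest := hm.abs_massAverage_le (a := fun k => Y k ω - (U k ω - ∫ ω, U k ω ∂P))
    (c := 2 * (ε / 3)) (fun k => ?_) n
  · rw [massAverage_sub] at hrest
    linarith [abs_sub_abs_le_abs_sub (massAverage m (Y · ω) n)
      (massAverage m (fun k => U k ω - ∫ ω, U k ω ∂P) n)]
  · rw [← sub_add]
    linarith [abs_add_le (Y k ω - U k ω) (∫ ω, U k ω ∂P), hmean k,
      abs_sub_tailPart_le hε3.le (Y k ω)]

theorem IsDivergentMass.summable_rpow_mul_integral_tailPart (hm : IsDivergentMass m)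
    {Y : ℕ → Ω → ℝ} {p r K δ D c : ℝ} (hp : 1 < p) (hpr : p < r) (hδ : 0 < δ)
    (hmeas : ∀ k, Measurable (Y k)) (hYr : ∀ k, Integrable (fun ω => |Y k ω| ^ r) P)
    (hK : ∀ k, ∫ ω, |Y k ω| ^ r ∂P ≤ K)
    (hD : ∀ k, P.real {ω | c < |Y k ω|} * m k ^ δ ≤ D) :
    Summable fun k => (m k / totalMass m (k + 1)) ^ p * ∫ ω, |tailPart c (Y k ω)| ^ p ∂P := by
  have hr : 0 < r := by linarith
  have hθ : 0 < 1 - p / r := sub_pos.2 ((div_lt_one hr).2 hpr)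
  set θ := 1 - p / r
  set η := min (p - 1) (δ * θ)
  have hη : 0 < η := lt_min (by linarith) (by positivity)
  refine Summable.of_nonneg_of_le (fun k => ?_) (fun k => ?_)
    ((hm.summable_div_succ_rpow hη).mul_left (K ^ (p / r) * (1 + D ^ θ)))
  · have := div_nonneg (hm.1 k) (hm.totalMass_nonneg (k + 1))
    exact mul_nonneg (by positivity) (integral_nonneg fun ω => by positivity)
  · have hKpow : (∫ ω, |Y k ω| ^ r ∂P) ^ (p / r) ≤ K ^ (p / r) :=
      Real.rpow_le_rpow (integral_nonneg fun ω => by positivity) (hK k) (by positivity)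
    have hprob := rpow_mul_rpow_le_one_add (hm.1 k) measureReal_nonneg measureReal_le_one hθ.le
      hη.le (min_le_right _ _) (hD k)
    have hw := div_nonneg (hm.1 k) (hm.totalMass_nonneg (k + 1))
    calc (m k / totalMass m (k + 1)) ^ p * ∫ ω, |tailPart c (Y k ω)| ^ p ∂P
        ≤ (m k / totalMass m (k + 1)) ^ p
            * (K ^ (p / r) * P.real {ω | c < |Y k ω|} ^ θ) := by
          gcongr
          exact (integral_abs_tailPart_rpow_le (by linarith) hpr (hmeas k) (hYr k) c).trans
            (mul_le_mul_of_nonneg_right hKpow (by positivity))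
      _ = K ^ (p / r) * ((m k / totalMass m (k + 1)) ^ p * P.real {ω | c < |Y k ω|} ^ θ) := by
          ring
      _ ≤ K ^ (p / r) * ((1 + D ^ θ) * (m k / totalMass m (k + 1) ^ (1 + η))) := by
          have hK0 : 0 ≤ K := (integral_nonneg fun ω => by positivity).trans (hK k)
          exact mul_le_mul_of_nonneg_left (div_rpow_mul_le (hm.1 k) (hm.le_totalMass_succ k) hη.le
            (min_le_left _ _) hprob (by positivity)) (by positivity)
      _ = _ := by ring

theorem IsDivergentMass.ae_tendsto_massAverage_of_tail (hm : IsDivergentMass m)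
    {Y : ℕ → Ω → ℝ} {β C δ : ℝ} (hβ : 1 < β) (hC : 0 ≤ C) (hδ : 0 < δ)
    (hmeas : ∀ k, Measurable (Y k)) (hind : iIndepFun Y P) (hint : ∀ k, Integrable (Y k) P)
    (hcent : ∀ k, ∫ ω, Y k ω ∂P = 0)
    (htail : ∀ k x, 0 < x → P.real {ω | x ≤ |Y k ω|} ≤ C / x ^ β)
    (hdecay : ∀ ε > 0, ∃ D, ∀ k, P.real {ω | ε < |Y k ω|} * m k ^ δ ≤ D) :
    ∀ᵐ ω ∂P, Tendsto (massAverage m fun k => Y k ω) atTop (𝓝 0) := by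
  obtain ⟨p, hp1, hp⟩ := exists_between (lt_min hβ one_lt_two)
  obtain ⟨r, hpr, hrβ⟩ := exists_between (lt_min_iff.1 hp).1
  refine hm.ae_tendsto_massAverage_of_summable_tailPart hp1.le (lt_min_iff.1 hp).2.le hmeas hind
    hint hcent (fun k => ?_) fun ε hε => ?_
  · exact integrable_abs_rpow_of_tail (hmeas k).aemeasurable (by linarith) (hpr.trans hrβ) hC
      (htail k)
  · obtain ⟨D, hD⟩ := hdecay ε hε
    exact hm.summable_rpow_mul_integral_tailPart hp1 hpr hδ hmeas
      (fun k => integrable_abs_rpow_of_tail (hmeas k).aemeasurable (by linarith) hrβ hC (htail k))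
      (fun k => integral_abs_rpow_le_of_tail (hmeas k).aemeasurable (by linarith) hrβ hC (htail k))
      hD

end WeightedAverages

section MaximalInequality

variable {Ω : Type*} [MeasurableSpace Ω] {P : Measure Ω}

/-- A tail bound of order `β` for the increments of the process `Z` over an interval of length `m`,
with the scaling of condition (S3), where `Z` is `s ↦ s X_k(s)`. -/
def IncrementTail (P : Measure Ω) (Z : ℝ → Ω → ℝ) (β C : ℝ) : Prop :=
  ∀ u r m : ℝ, 0 < u → 0 < r → 0 < m →
    P.real {ω | ∃ s ∈ Set.Icc 0 m, u ≤ |Z (r + s) ω - Z r ω|} ≤ C * (m / u) ^ β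

/-- The tail bound of `IncrementTail` for the running maximum of the process `Z` over `(0, m]`. -/
def MaximalTail (P : Measure Ω) (Z : ℝ → Ω → ℝ) (β C : ℝ) : Prop :=
  ∀ u m : ℝ, 0 < u → 0 < m →
    P.real {ω | ∃ s ∈ Set.Ioc 0 m, u ≤ |Z s ω|} ≤ C * (m / u) ^ β

variable [IsFiniteMeasure P] {Z : ℝ → Ω → ℝ} {β C : ℝ}

theorem IncrementTail.measureReal_Icc_le (h : IncrementTail P Z β C) {u r m : ℝ} (hu : 0 < u)
    (hr : 0 < r) (hm : 0 < m) :
    P.real {ω | ∃ s ∈ Set.Icc r m, u ≤ |Z s ω|}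
      ≤ C * 2 ^ β * (m / u) ^ β + P.real {ω | u / 2 ≤ |Z r ω|} := by
  have hincr := h (u / 2) r m (half_pos hu) hr hm
  rw [show m / (u / 2) = 2 * (m / u) by field_simp, Real.mul_rpow zero_le_two (by positivity),
    ← mul_assoc] at hincr
  refine (measureReal_mono ?_).trans ((measureReal_union_le _ _).trans (add_le_add_left hincr _))
  rintro ω ⟨s, hs, hle⟩
  by_cases hstart : u / 2 ≤ |Z r ω|
  · exact Or.inr hstart
  · refine Or.inl ⟨s - r, ⟨sub_nonneg.2 hs.1, by linarith [hs.2]⟩, ?_⟩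
    rw [add_sub_cancel]
    linarith [abs_sub_abs_le_abs_sub (Z s ω) (Z r ω)]

theorem IncrementTail.maximalTail (h : IncrementTail P Z β C)
    (h0 : TendstoInMeasure P Z (𝓝[>] 0) 0) : MaximalTail P Z β (C * 2 ^ β) := by
  intro u m hu hm
  let r : ℕ → ℝ := fun n => m / (n + 1)
  have hr : ∀ n, 0 < r n := fun n => by positivity
  have hr0 : Tendsto r atTop (𝓝 0) := by
    simpa [r, div_eq_mul_inv] using
      (tendsto_one_div_add_atTop_nhds_zero_nat (𝕜 := ℝ)).const_mul m
  let E : ℕ → Set Ω := fun n => {ω | ∃ s ∈ Set.Icc (r n) m, u ≤ |Z s ω|}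
  have hmono : Monotone E := by
    rintro a b hab ω ⟨s, hs, hle⟩
    refine ⟨s, ⟨le_trans ?_ hs.1, hs.2⟩, hle⟩
    simp only [r]
    gcongr
  have hunion : {ω | ∃ s ∈ Set.Ioc 0 m, u ≤ |Z s ω|} ⊆ ⋃ n, E n := by
    rintro ω ⟨s, hs, hle⟩
    obtain ⟨n, hn⟩ := (hr0.eventually_lt_const hs.1).exists
    exact Set.mem_iUnion.2 ⟨n, s, ⟨hn.le, hs.2⟩, hle⟩
  have hstart : Tendsto (fun n => P.real {ω | u / 2 ≤ |Z (r n) ω|}) atTop (𝓝 0) := by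
    have hr0' : Tendsto r atTop (𝓝[>] 0) := tendsto_nhdsWithin_iff.2 ⟨hr0, .of_forall hr⟩
    simpa [Function.comp_def] using
      (tendstoInMeasure_iff_measureReal_norm.1 h0 _ (half_pos hu)).comp hr0'
  have hlim : Tendsto (fun n => P.real (E n)) atTop (𝓝 (P.real (⋃ n, E n))) :=
    (ENNReal.tendsto_toReal (measure_ne_top _ _)).comp (tendsto_measure_iUnion_atTop hmono)
  refine (measureReal_mono hunion).trans (le_of_tendsto_of_tendsto' hlim ?_
    fun n => h.measureReal_Icc_le hu (hr n) hm)
  simpa using hstart.const_add (C * 2 ^ β * (m / u) ^ β)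

theorem MaximalTail.measureReal_le (h : MaximalTail P Z β C) {x m : ℝ} (hx : 0 < x) (hm : 0 < m) :
    P.real {ω | m * x ≤ |Z m ω|} ≤ C / x ^ β := by
  have hmax := h (m * x) m (by positivity) hm
  rw [div_mul_cancel_left₀ hm.ne', Real.inv_rpow hx.le, ← div_eq_mul_inv] at hmax
  refine (measureReal_mono fun ω hω => ?_).trans hmax
  exact ⟨m, ⟨hm, le_rfl⟩, hω⟩

end MaximalInequality

section RunningIncrement

theorem pow_succ_sub_pow_succ_le {a b : ℝ} (ha : 0 ≤ a) (hab : a ≤ b) (q : ℕ) :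
    b ^ (q + 1) - a ^ (q + 1) ≤ (b - a) * ((q + 1) * b ^ q) := by
  have h := abs_pow_sub_pow_le b a (q + 1)
  rw [abs_of_nonneg (sub_nonneg.2 hab), abs_of_nonneg (ha.trans hab), abs_of_nonneg ha,
    max_eq_left hab, Nat.add_sub_cancel, mul_assoc] at h
  exact_mod_cast (le_abs_self _).trans h

theorem eventually_exists_pow_le_lt {n : ℕ} (hn : n ≠ 0) {Q : ℕ → Prop}
    (hQ : ∀ᶠ j in atTop, Q j) :
    ∀ᶠ t : ℝ in atTop, ∃ j : ℕ, Q j ∧ (j : ℝ) ^ n ≤ t ∧ t < ((j : ℝ) + 1) ^ n := by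
  have hroot : Tendsto (fun t : ℝ => ⌊t ^ (n : ℝ)⁻¹⌋₊) atTop atTop :=
    tendsto_nat_floor_atTop.comp (tendsto_rpow_atTop (by positivity))
  filter_upwards [hroot.eventually hQ, eventually_ge_atTop 0] with t ht ht0
  have hpow := Real.rpow_inv_natCast_pow ht0 hn
  refine ⟨_, ht, ?_, ?_⟩
  · calc (⌊t ^ (n : ℝ)⁻¹⌋₊ : ℝ) ^ n ≤ (t ^ (n : ℝ)⁻¹) ^ n := by
          gcongr
          exact Nat.floor_le (by positivity)
      _ = t := hpow
  · calc t = (t ^ (n : ℝ)⁻¹) ^ n := hpow.symm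
      _ < (⌊t ^ (n : ℝ)⁻¹⌋₊ + 1 : ℝ) ^ n := by
          gcongr
          exact Nat.lt_floor_add_one _

variable {Ω : Type*} [MeasurableSpace Ω] {P : Measure Ω} [IsFiniteMeasure P]

theorem ae_eventually_notMem_of_measureReal_le {A : ℕ → Set Ω} {b : ℕ → ℝ} (hb : Summable b)
    (hle : ∀ᶠ k in atTop, P.real (A k) ≤ b k) : ∀ᵐ ω ∂P, ∀ᶠ k in atTop, ω ∉ A k := by
  have hsum : Summable fun k => P.real (A k) :=
    Summable.of_norm_bounded_eventually_nat hb
      (hle.mono fun k hk => by rwa [Real.norm_of_nonneg measureReal_nonneg])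
  refine ae_eventually_notMem ?_
  have hfin := hsum.tsum_ofReal_ne_top
  simp only [ofReal_measureReal (measure_ne_top P _)] at hfin
  exact hfin

theorem div_rpow_le_of_le_rpow {h M c α β : ℝ} (hh : 0 ≤ h) (hM : 0 < M) (hc : 0 ≤ c) (hβ : 1 ≤ β)
    (hle : h ≤ c * M ^ α) :
    (h / M) ^ β ≤ c ^ (β - 1) * (h / M ^ (1 + (1 - α) * (β - 1))) := by
  rcases hh.eq_or_lt with rfl | hh
  · rcases hβ.eq_or_lt with rfl | hβ
    · simp
    · simp [Real.zero_rpow (by linarith : β ≠ 0)]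
  calc (h / M) ^ β = h / M * (h / M) ^ (β - 1) := by
        rw [← Real.rpow_one_add' (by positivity) (by linarith), add_sub_cancel]
    _ ≤ h / M * (c * M ^ (α - 1)) ^ (β - 1) := by
        gcongr
        rw [Real.rpow_sub_one hM.ne', mul_div_assoc']
        gcongr
    _ = c ^ (β - 1) * (h / M ^ (1 + (1 - α) * (β - 1))) := by
        rw [Real.mul_rpow hc (by positivity), ← Real.rpow_mul hM.le, Real.rpow_add hM,
          Real.rpow_one, show (α - 1) * (β - 1) = -((1 - α) * (β - 1)) by ring,
          Real.rpow_neg hM.le]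
        field_simp


variable {m : ℕ → ℝ} {Z : ℕ → ℝ → Ω → ℝ} {β C : ℝ}

theorem IsDivergentMass.ae_eventually_abs_lt_of_le_rpow (hm : IsDivergentMass m)
    (hZ : ∀ k, MaximalTail P (Z k) β C) (hβ : 1 < β) (hC : 0 ≤ C) {α c ε : ℝ} (hα : α < 1)
    (hc : 0 ≤ c) (hε : 0 < ε) :
    ∀ᵐ ω ∂P, ∀ᶠ k in atTop, ∀ s, 0 < s → s ≤ m k → s ≤ c * totalMass m k ^ α →
      |Z k s ω| < ε * totalMass m k := by
  let h : ℕ → ℝ := fun k => min (m k) (c * totalMass m k ^ α)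
  have hh0 : ∀ k, 0 ≤ h k := fun k =>
    le_min (hm.1 k) (mul_nonneg hc (Real.rpow_nonneg (hm.totalMass_nonneg k) _))
  have hle : ∀ᶠ k in atTop, h k ≤ c * totalMass m k := by
    filter_upwards [hm.2.eventually_ge_atTop 1] with k hk
    refine (min_le_right _ _).trans (mul_le_mul_of_nonneg_left ?_ hc)
    simpa using Real.rpow_le_rpow_of_exponent_le hk hα.le
  have hsum := (hm.summable_div_rpow hh0 (fun k => min_le_left _ _) hc hle
    (mul_pos (sub_pos.2 hα) (sub_pos.2 hβ))).mul_left (C * (1 / ε) ^ β * c ^ (β - 1))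
  have hprob : ∀ᶠ k in atTop,
      P.real {ω | ∃ s ∈ Set.Ioc 0 (h k), ε * totalMass m k ≤ |Z k s ω|}
        ≤ C * (1 / ε) ^ β * c ^ (β - 1)
          * (h k / totalMass m k ^ (1 + (1 - α) * (β - 1))) := by
    filter_upwards [hm.2.eventually_gt_atTop 0] with k hM
    rcases (hh0 k).eq_or_lt with hk | hk
    · simp [← hk]
    calc P.real {ω | ∃ s ∈ Set.Ioc 0 (h k), ε * totalMass m k ≤ |Z k s ω|}
        ≤ C * (h k / (ε * totalMass m k)) ^ β := hZ k _ _ (by positivity) hk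
      _ = C * (1 / ε) ^ β * (h k / totalMass m k) ^ β := by
          rw [mul_assoc, ← Real.mul_rpow (by positivity) (by positivity), div_mul_div_comm, one_mul]
      _ ≤ C * (1 / ε) ^ β * (c ^ (β - 1)
            * (h k / totalMass m k ^ (1 + (1 - α) * (β - 1)))) := by
          gcongr
          exact div_rpow_le_of_le_rpow hk.le hM hc hβ.le (min_le_right _ _)
      _ = _ := (mul_assoc _ _ _).symm
  filter_upwards [ae_eventually_notMem_of_measureReal_le hsum hprob] with ω hω
  filter_upwards [hω] with k hk s hs hsm hsc
  exact not_le.1 fun hle => hk ⟨s, ⟨hs, le_min hsm hsc⟩, hle⟩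

theorem ae_eventually_abs_le_of_pow_le {Y : ℕ → Ω → ℝ} {s : ℕ → ℝ} {q : ℕ} {ε D δ : ℝ}
    (hq : 1 < q * δ) (hδ : 0 < δ) (hs : ∀ j : ℕ, (j : ℝ) ^ q ≤ s j)
    (hY : ∀ j, 0 < s j → P.real {ω | ε * s j < |Y j ω|} ≤ D / s j ^ δ) :
    ∀ᵐ ω ∂P, ∀ᶠ j in atTop, |Y j ω| ≤ ε * s j := by
  have hprob : ∀ᶠ j : ℕ in atTop,
      P.real {ω | ε * s j < |Y j ω|} ≤ |D| * (1 / (j : ℝ) ^ (q * δ)) := by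
    filter_upwards [eventually_gt_atTop 0] with j hj
    have hjq : (0 : ℝ) < (j : ℝ) ^ q := by positivity
    refine (hY j (hjq.trans_le (hs j))).trans ?_
    rw [mul_one_div, Real.rpow_mul (Nat.cast_nonneg j), Real.rpow_natCast]
    gcongr
    · exact le_abs_self D
    · exact hs j
  have hsum := (Real.summable_one_div_nat_rpow.2 hq).mul_left |D|
  filter_upwards [ae_eventually_notMem_of_measureReal_le hsum hprob] with ω hω
  exact hω.mono fun j hj => not_lt.1 hj

theorem ae_eventually_abs_sub_lt_mul_pow {s : ℕ → ℝ} (hZ : ∀ j, IncrementTail P (Z j) β C)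
    (hβ : 1 < β) (hC : 0 ≤ C) (hs : ∀ᶠ j in atTop, 0 < s j) (q : ℕ) {ε : ℝ} (hε : 0 < ε) :
    ∀ᵐ ω ∂P, ∀ᶠ j : ℕ in atTop,
      ∀ r ∈ Set.Icc (0 : ℝ) (((j : ℝ) + 1) ^ (q + 1) - (j : ℝ) ^ (q + 1)),
      |Z j (s j + r) ω - Z j (s j) ω| < ε * (j : ℝ) ^ (q + 1) := by
  let gap : ℕ → ℝ := fun j => ((j : ℝ) + 1) ^ (q + 1) - (j : ℝ) ^ (q + 1)
  have hprob : ∀ᶠ j : ℕ in atTop,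
      P.real {ω | ∃ r ∈ Set.Icc 0 (gap j), ε * (j : ℝ) ^ (q + 1) ≤ |Z j (s j + r) ω - Z j (s j) ω|}
        ≤ C * ((q + 1) * 2 ^ q / ε) ^ β * (1 / (j : ℝ) ^ β) := by
    filter_upwards [hs, eventually_ge_atTop 1] with j hsj hj
    have hj1 : (1 : ℝ) ≤ j := mod_cast hj
    have hgap0 : 0 < gap j := sub_pos.2 (by gcongr; linarith)
    have hgap : gap j ≤ (q + 1) * 2 ^ q * (j : ℝ) ^ q :=
      calc gap j ≤ (q + 1) * ((j : ℝ) + 1) ^ q := by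
            have := pow_succ_sub_pow_succ_le (Nat.cast_nonneg j) (lt_add_one (j : ℝ)).le q
            rwa [add_sub_cancel_left, one_mul] at this
        _ ≤ (q + 1) * (2 * j) ^ q := by gcongr; linarith
        _ = (q + 1) * 2 ^ q * (j : ℝ) ^ q := by rw [mul_pow, mul_assoc]
    calc _ ≤ C * (gap j / (ε * (j : ℝ) ^ (q + 1))) ^ β := hZ j _ _ _ (by positivity) hsj hgap0
      _ ≤ C * ((q + 1) * 2 ^ q / ε * (1 / j)) ^ β := by
          gcongr
          rw [div_mul_div_comm, mul_one, div_le_div_iff₀ (by positivity) (by positivity)]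
          calc gap j * (ε * j) ≤ (q + 1) * 2 ^ q * (j : ℝ) ^ q * (ε * j) := by gcongr
            _ = _ := by ring
      _ = _ := by
          rw [Real.mul_rpow (by positivity) (by positivity),
            Real.div_rpow zero_le_one (Nat.cast_nonneg j), Real.one_rpow, mul_assoc]
  have hsum := (Real.summable_one_div_nat_rpow.2 hβ).mul_left (C * ((q + 1) * 2 ^ q / ε) ^ β)
  filter_upwards [ae_eventually_notMem_of_measureReal_le hsum hprob] with ω hω
  exact hω.mono fun j hj r hr => not_le.1 fun hle => hj ⟨r, hr, hle⟩

theorem pow_le_pow_succ_sub_pred_pow_succ {x : ℝ} (hx : 1 ≤ x) (q : ℕ) :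
    x ^ q ≤ x ^ (q + 1) - (x - 1) ^ (q + 1) := by
  have : (x - 1) ^ (q + 1) ≤ x ^ q * (x - 1) := by
    rw [pow_succ]
    gcongr
    linarith
  rw [pow_succ x]
  linarith

theorem pow_succ_sub_pred_pow_succ_le_rpow {x M : ℝ} (hx : 2 ≤ x) (q : ℕ)
    (hM : (x - 1) ^ (q + 1) ≤ M) :
    (x + 1) ^ (q + 1) - (x - 1) ^ (q + 1) ≤ 2 * (q + 1) * 3 ^ q * M ^ ((q : ℝ) / (q + 1)) := by
  have hx1 : 0 ≤ x - 1 := by linarith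
  calc (x + 1) ^ (q + 1) - (x - 1) ^ (q + 1)
      ≤ (x + 1 - (x - 1)) * ((q + 1) * (x + 1) ^ q) :=
        pow_succ_sub_pow_succ_le hx1 (by linarith) q
    _ ≤ 2 * ((q + 1) * (3 * (x - 1)) ^ q) := by
        gcongr <;> linarith
    _ = 2 * (q + 1) * 3 ^ q * ((x - 1) ^ (q + 1)) ^ ((q : ℝ) / (q + 1)) := by
        rw [← Real.rpow_natCast _ (q + 1), ← Real.rpow_mul hx1, Nat.cast_add_one,
          mul_div_cancel₀ _ (by positivity : (q : ℝ) + 1 ≠ 0), Real.rpow_natCast, mul_pow]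
        ring
    _ ≤ 2 * (q + 1) * 3 ^ q * M ^ ((q : ℝ) / (q + 1)) := by gcongr

theorem IsDivergentMass.lastIndex_eq_or_elapsed_le (hm : IsDivergentMass m) {q : ℕ} {x t : ℝ}
    (hx : 2 ≤ x) (hxt : x ^ (q + 1) ≤ t) (htx : t < (x + 1) ^ (q + 1)) :
    (lastIndex m (x ^ (q + 1)) - 1 = lastIndex m t - 1 ∧ x ^ q ≤ elapsed m (x ^ (q + 1))) ∨
      elapsed m t
        ≤ 2 * (q + 1) * 3 ^ q * totalMass m (lastIndex m t - 1) ^ ((q : ℝ) / (q + 1)) := by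
  rcases le_total (totalMass m (lastIndex m t - 1)) ((x - 1) ^ (q + 1)) with hM | hM
  · have hpow := pow_le_pow_succ_sub_pred_pow_succ (by linarith : 1 ≤ x) q
    have hxq : 0 < x ^ q := by positivity
    have hindex : lastIndex m (x ^ (q + 1)) - 1 = lastIndex m t - 1 :=
      hm.lastIndex_sub_one_eq (by positivity) (by linarith)
        (hxt.trans (hm.le_totalMass_lastIndex t))
    refine Or.inl ⟨hindex, ?_⟩
    rw [elapsed, hindex]
    linarith
  · refine Or.inr (le_trans ?_ (pow_succ_sub_pred_pow_succ_le_rpow hx q hM))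
    rw [elapsed]
    linarith

theorem elapsed_add_sub {t u : ℝ} (h : lastIndex m u - 1 = lastIndex m t - 1) :
    elapsed m u + (t - u) = elapsed m t := by
  rw [elapsed, elapsed, h]
  ring

theorem IsDivergentMass.ae_eventually_abs_le_of_pow_le_elapsed (hm : IsDivergentMass m)
    {q : ℕ} {δ ε : ℝ} (hZ : ∀ k, IncrementTail P (Z k) β C) (hβ : 1 < β) (hC : 0 ≤ C)
    (hq : 1 < q * δ) (hδ : 0 < δ) (hε : 0 < ε)
    (hdecay : ∀ ε > 0, ∃ D, ∀ k s, 0 < s → P.real {ω | ε * s < |Z k s ω|} ≤ D / s ^ δ) :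
    ∀ᵐ ω ∂P, ∀ᶠ j : ℕ in atTop, ∀ t, (j : ℝ) ^ (q + 1) ≤ t → t < ((j : ℝ) + 1) ^ (q + 1) →
      lastIndex m ((j : ℝ) ^ (q + 1)) - 1 = lastIndex m t - 1 →
      (j : ℝ) ^ q ≤ elapsed m ((j : ℝ) ^ (q + 1)) →
      |Z (lastIndex m t - 1) (elapsed m t) ω| ≤ ε * t := by
  let i : ℕ → ℕ := fun j => lastIndex m ((j : ℝ) ^ (q + 1)) - 1
  let s : ℕ → ℝ := fun j => max (elapsed m ((j : ℝ) ^ (q + 1))) ((j : ℝ) ^ q)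
  have hs : ∀ j : ℕ, (j : ℝ) ^ q ≤ s j := fun j => le_max_right _ _
  have hs0 : ∀ᶠ j in atTop, 0 < s j := by
    filter_upwards [eventually_gt_atTop 0] with j hj
    exact (by positivity : (0 : ℝ) < (j : ℝ) ^ q).trans_le (hs j)
  obtain ⟨D, hD⟩ := hdecay (ε / 2) (half_pos hε)
  filter_upwards [ae_eventually_abs_le_of_pow_le (Y := fun j => Z (i j) (s j)) hq hδ hs
      fun j => hD (i j) (s j),
    ae_eventually_abs_sub_lt_mul_pow (fun j => hZ (i j)) hβ hC hs0 q (half_pos hε)]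
    with ω hvalue hincrement
  filter_upwards [hvalue, hincrement] with j hvalue hincrement t hjt htj hi hlate
  have hsj : s j = elapsed m ((j : ℝ) ^ (q + 1)) := max_eq_left hlate
  have hstart : s j ≤ (j : ℝ) ^ (q + 1) := hsj.trans_le (sub_le_self _ (hm.totalMass_nonneg _))
  have hdiff := hincrement (t - (j : ℝ) ^ (q + 1)) ⟨by linarith, by linarith⟩
  simp only [i, hi, hsj, elapsed_add_sub hi] at hvalue hdiff
  nlinarith [abs_sub_abs_le_abs_sub (Z (lastIndex m t - 1) (elapsed m t) ω)
    (Z (lastIndex m t - 1) (elapsed m ((j : ℝ) ^ (q + 1))) ω)]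

theorem IsDivergentMass.ae_tendsto_running_div (hm : IsDivergentMass m) {K δ : ℝ}
    (hincr : ∀ k, IncrementTail P (Z k) β C) (hmax : ∀ k, MaximalTail P (Z k) β K)
    (hβ : 1 < β) (hC : 0 ≤ C) (hK : 0 ≤ K) (hδ : 0 < δ)
    (hdecay : ∀ ε > 0, ∃ D, ∀ k s, 0 < s → P.real {ω | ε * s < |Z k s ω|} ≤ D / s ^ δ) :
    ∀ᵐ ω ∂P, Tendsto (fun t => Z (lastIndex m t - 1) (elapsed m t) ω / t) atTop (𝓝 0) := by
  obtain ⟨q, hq⟩ := exists_nat_gt (1 / δ)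
  rw [div_lt_iff₀ hδ] at hq
  have hα : (q : ℝ) / (q + 1) < 1 := (div_lt_one (by positivity)).2 (lt_add_one _)
  refine ae_tendsto_zero_of_ae_eventually_abs_le
    (f := fun t ω => Z (lastIndex m t - 1) (elapsed m t) ω / t) fun ε hε => ?_
  filter_upwards [hm.ae_eventually_abs_lt_of_le_rpow hmax hβ hK hα
      (by positivity : (0 : ℝ) ≤ 2 * (q + 1) * 3 ^ q) hε,
    hm.ae_eventually_abs_le_of_pow_le_elapsed hincr hβ hC hq hδ hε hdecay] with ω hearly hlate
  filter_upwards [eventually_gt_atTop 0, hm.tendsto_lastIndex_sub_one.eventually hearly,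
    eventually_exists_pow_le_lt q.add_one_ne_zero (hlate.and (eventually_ge_atTop 2))]
    with t ht hearly ⟨j, ⟨hlate, hj⟩, hjt, htj⟩
  rw [abs_div, abs_of_pos ht, div_le_iff₀ ht]
  rcases hm.lastIndex_eq_or_elapsed_le (mod_cast hj : (2 : ℝ) ≤ j) hjt htj with ⟨hi, hle⟩ | hle
  · exact hlate t hjt htj hi hle
  · have hMt := totalMass_lastIndex_lt m ht
    refine (hearly _ (sub_pos.2 hMt) (hm.elapsed_le t) hle).le.trans ?_
    gcongr

end RunningIncrement

section Conditions

variable {Ω : Type*} [MeasurableSpace Ω] {P : Measure Ω}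

theorem lintegral_posPart_le_of_tail_le {Y : Ω → ℝ} {ν : Measure ℝ} (hY : AEMeasurable Y P)
    (htail : ∀ x, P {ω | x < Y ω} ≤ ν (Set.Ioi x)) :
    ∫⁻ ω, ENNReal.ofReal (max (Y ω) 0) ∂P ≤ ∫⁻ x, ENNReal.ofReal (max x 0) ∂ν := by
  rw [lintegral_eq_lintegral_meas_lt P (f := fun ω => max (Y ω) 0)
      (ae_of_all _ fun ω => le_max_right _ _)
      (hY.max aemeasurable_const),
    lintegral_eq_lintegral_meas_lt ν (f := fun x : ℝ => max x 0)
      (ae_of_all _ fun x => le_max_right _ _) (measurable_id.max measurable_const).aemeasurable]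
  refine setLIntegral_mono' measurableSet_Ioi fun t ht => ?_
  simp only [lt_max_iff, not_lt.2 (Set.mem_Ioi.1 ht).le, or_false]
  exact htail t

theorem integral_abs_eq_two_mul_integral_posPart {Y : Ω → ℝ} (hY : Integrable Y P)
    (hY0 : ∫ ω, Y ω ∂P = 0) : ∫ ω, |Y ω| ∂P = 2 * ∫ ω, max (Y ω) 0 ∂P := by
  have habs : ∀ ω, |Y ω| = 2 * max (Y ω) 0 - Y ω := fun ω => by
    rcases le_total (Y ω) 0 with h | h
    · rw [abs_of_nonpos h, max_eq_right h]
      ring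
    · rw [abs_of_nonneg h, max_eq_left h]
      ring
  simp_rw [habs]
  rw [integral_sub (hY.pos_part.const_mul 2) hY, hY0, integral_const_mul, sub_zero]

theorem integral_abs_le_of_tail_le {Y : Ω → ℝ} {ν : Measure ℝ} (hY : Integrable Y P)
    (hY0 : ∫ ω, Y ω ∂P = 0) (hν : Integrable (fun x : ℝ => x) ν)
    (htail : ∀ x, P {ω | x < Y ω} ≤ ν (Set.Ioi x)) :
    ∫ ω, |Y ω| ∂P ≤ 2 * ∫ x, max x 0 ∂ν := by
  rw [integral_abs_eq_two_mul_integral_posPart hY hY0,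
    integral_eq_lintegral_of_nonneg_ae (f := fun ω => max (Y ω) 0)
      (ae_of_all _ fun ω => le_max_right _ _) hY.pos_part.aestronglyMeasurable,
    integral_eq_lintegral_of_nonneg_ae (f := fun x : ℝ => max x 0)
      (ae_of_all _ fun x => le_max_right _ _) hν.pos_part.aestronglyMeasurable]
  gcongr
  · exact hν.pos_part.lintegral_lt_top.ne
  · exact lintegral_posPart_le_of_tail_le hY.aemeasurable htail

theorem integrable_id_of_integrable_abs_rpow {ν : Measure ℝ} [IsFiniteMeasure ν] {p : ℝ}
    (hp : 1 ≤ p) (h : Integrable (fun x : ℝ => |x| ^ p) ν) : Integrable (fun x : ℝ => x) ν := by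
  refine ((integrable_const 1).add h).mono' aestronglyMeasurable_id (ae_of_all _ fun x => ?_)
  have hpow : 0 ≤ |x| ^ p := by positivity
  rw [Real.norm_eq_abs, Pi.add_apply]
  rcases le_total |x| 1 with hx | hx
  · linarith
  · linarith [Real.self_le_rpow_of_one_le hx hp]

theorem tendstoInMeasure_mul_of_integral_abs_le [IsFiniteMeasure P] {Y : ℝ → Ω → ℝ} {K : ℝ}
    (hY : ∀ r, 0 < r → Integrable (Y r) P) (hK : ∀ r, 0 < r → ∫ ω, |Y r ω| ∂P ≤ K) :
    TendstoInMeasure P (fun r ω => r * Y r ω) (𝓝[>] 0) 0 := by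
  refine tendstoInMeasure_iff_measureReal_norm.2 fun ε hε => ?_
  have hlim : Tendsto (fun r : ℝ => r * K / ε) (𝓝[>] 0) (𝓝 0) := by
    have hcont : Continuous fun r : ℝ => r * K / ε := by fun_prop
    exact (hcont.tendsto' 0 0 (by simp)).mono_left nhdsWithin_le_nhds
  refine squeeze_zero' (.of_forall fun r => measureReal_nonneg) ?_ hlim
  filter_upwards [self_mem_nhdsWithin] with r hr
  have hr : 0 < r := hr
  have markov := mul_meas_ge_le_integral_of_nonneg (ae_of_all P fun ω => norm_nonneg (r * Y r ω))
    ((hY r hr).const_mul r).norm ε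
  simp only [norm_mul, Real.norm_of_nonneg hr.le, integral_const_mul, Real.norm_eq_abs] at markov
  rw [le_div_iff₀' hε]
  simpa [abs_mul, abs_of_pos hr] using
    markov.trans (mul_le_mul_of_nonneg_left (hK r hr) hr.le)

variable {X : ℕ → ℝ → Ω → ℝ}

theorem StochasticDomination.tendstoInMeasure_mul [IsFiniteMeasure P]
    (hS2 : StochasticDomination P X) (hX : IsIndependentFamily P X) (hC : Centered P X) (k : ℕ) :
    TendstoInMeasure P (fun r ω => r * X k r ω) (𝓝[>] 0) 0 := by
  obtain ⟨ν, γ, hν, hγ, hint, htail⟩ := hS2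
  have hid := integrable_id_of_integrable_abs_rpow (by linarith) hint
  exact tendstoInMeasure_mul_of_integral_abs_le (hX.integrable k) fun r hr =>
    integral_abs_le_of_tail_le (hX.integrable k r hr) (hC k r hr) hid fun x => htail x k r hr

theorem PolynomialDecay.exists_measureReal_le (hS1 : PolynomialDecay P X) :
    ∃ δ : ℝ, 0 < δ ∧ ∀ ε > 0, ∃ D, ∀ k s, 0 < s → P.real {ω | ε < |X k s ω|} ≤ D / s ^ δ := by
  obtain ⟨δ, hδ, h⟩ := hS1
  refine ⟨δ, hδ, fun ε hε => ?_⟩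
  obtain ⟨D, hD⟩ := h ε hε
  refine ⟨D, fun k s hs => ?_⟩
  have hlt := (le_iSup _ k).trans_lt (hD s hs)
  exact ENNReal.toReal_le_of_le_ofReal (ENNReal.ofReal_pos.1 (bot_le.trans_lt hlt)).le hlt.le

theorem SlowIncrementGrowth.exists_incrementTail (hS3 : SlowIncrementGrowth P X) :
    ∃ β C, 1 < β ∧ 0 < C ∧ ∀ k, IncrementTail P (fun s ω => s * X k s ω) β C := by
  obtain ⟨β, C, hβ, hC, h⟩ := hS3 1 one_pos
  refine ⟨β, C, hβ, hC, fun k u r m hu hr hm => ?_⟩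
  rw [Real.div_rpow hm.le hu.le, ← mul_div_assoc]
  refine ENNReal.toReal_le_of_le_ofReal (by positivity) (le_trans ?_ (h u r m hu hr hm))
  refine le_iSup_of_le k (measure_mono ?_)
  rintro ω ⟨s, hs, hle⟩
  refine le_trans ?_ (le_iSup₂ (f := fun s _ => ‖(r + s) * X k (r + s) ω - r * X k r ω‖ₑ) s hs)
  rw [mul_one, Real.enorm_eq_ofReal_abs]
  exact ENNReal.ofReal_le_ofReal hle

variable [IsProbabilityMeasure P] {m : ℕ → ℝ}

theorem IsIndependentFamily.ae_tendsto_massAverage_of_le (hX : IsIndependentFamily P X)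
    (hC : Centered P X) (hm : IsDivergentMass m) {s : ℕ → ℝ} (hs : ∀ k, 0 < s k)
    (hms : ∀ k, m k ≤ s k) {β K δ : ℝ} (hβ : 1 < β) (hK : 0 ≤ K) (hδ : 0 < δ)
    (hmax : ∀ k, MaximalTail P (fun s ω => s * X k s ω) β K)
    (hdecay : ∀ ε > 0, ∃ D, ∀ k s, 0 < s → P.real {ω | ε < |X k s ω|} ≤ D / s ^ δ) :
    ∀ᵐ ω ∂P, Tendsto (massAverage m fun k => X k (s k) ω) atTop (𝓝 0) := by
  refine hm.ae_tendsto_massAverage_of_tail (Y := fun k => X k (s k)) hβ hK hδ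
    (fun k => hX.measurable k _ (hs k))
    (hX.indep.comp (fun k path => path ⟨s k, hs k⟩) fun k => measurable_pi_apply _)
    (fun k => hX.integrable k _ (hs k)) (fun k => hC k _ (hs k)) (fun k x hx => ?_) fun ε hε => ?_
  · simpa [abs_mul, abs_of_pos (hs k), hs k] using (hmax k).measureReal_le hx (hs k)
  · obtain ⟨D, hD⟩ := hdecay ε hε
    refine ⟨D, fun k => le_trans ?_
      ((le_div_iff₀ (Real.rpow_pos_of_pos (hs k) δ)).1 (hD k _ (hs k)))⟩
    have := hm.1 k
    gcongr
    exact hms k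

theorem IsIndependentFamily.ae_tendsto_massAverage (hX : IsIndependentFamily P X)
    (hC : Centered P X) (hm : IsDivergentMass m) {β K δ : ℝ} (hβ : 1 < β) (hK : 0 ≤ K)
    (hδ : 0 < δ) (hmax : ∀ k, MaximalTail P (fun s ω => s * X k s ω) β K)
    (hdecay : ∀ ε > 0, ∃ D, ∀ k s, 0 < s → P.real {ω | ε < |X k s ω|} ≤ D / s ^ δ) :
    ∀ᵐ ω ∂P, Tendsto (massAverage m fun k => X k (m k) ω) atTop (𝓝 0) := by
  -- `X k 0` is arbitrary, so a vanishing mass is replaced by `1` before evaluating `X k`.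
  let s : ℕ → ℝ := fun k => if 0 < m k then m k else 1
  have hs : ∀ k, 0 < s k ∧ m k ≤ s k := fun k => by
    simp only [s]
    split_ifs with h
    exacts [⟨h, le_rfl⟩, ⟨one_pos, (not_lt.1 h).trans zero_le_one⟩]
  have hmul : ∀ k ω, m k * X k (s k) ω = m k * X k (m k) ω := fun k ω => by
    rcases (hm.1 k).eq_or_lt with h | h
    · simp [← h]
    · simp [s, h]
  filter_upwards [hX.ae_tendsto_massAverage_of_le hC hm (fun k => (hs k).1) (fun k => (hs k).2)
    hβ hK hδ hmax hdecay] with ω hω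
  exact hω.congr fun n => by simp only [massAverage, hmul]

end Conditions

end MassLLN

theorem theorem2p3_general {Ω : Type*} [MeasurableSpace Ω] (P : Measure Ω) [IsProbabilityMeasure P]
    (X : ℕ → ℝ → Ω → ℝ)
    (hX : MassLLN.IsIndependentFamily P X)
    (hC : MassLLN.Centered P X)
    (hS1 : MassLLN.PolynomialDecay P X)
    (h0 : ∀ k, TendstoInMeasure P (fun r ω => r * X k r ω) (𝓝[>] 0) 0)
    (hS3 : MassLLN.SlowIncrementGrowth P X)
    (m : ℕ → ℝ) (hm : MassLLN.IsDivergentMass m) :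
    ∀ᵐ ω ∂P, Tendsto (fun t : ℝ => MassLLN.gradualSum X m t ω) atTop (𝓝 0) := by
  obtain ⟨δ, hδ, hdecay⟩ := hS1.exists_measureReal_le
  obtain ⟨β, C, hβ, hC0, hincr⟩ := hS3.exists_incrementTail
  have hmax := fun k => (hincr k).maximalTail (h0 k)
  have hK : 0 ≤ C * 2 ^ β := by positivity
  have hcompleted := hX.ae_tendsto_massAverage hC hm hβ hK hδ hmax hdecay
  have hrunning := hm.ae_tendsto_running_div hincr hmax hβ hC0.le hK hδ fun ε hε => by
    obtain ⟨D, hD⟩ := hdecay ε hε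
    refine ⟨D, fun k s hs => ?_⟩
    simpa only [abs_mul, abs_of_pos hs, mul_comm ε, mul_lt_mul_iff_right₀ hs] using hD k s hs
  filter_upwards [hcompleted, hrunning] with ω hcompleted hrunning
  have hsum := (hm.tendsto_completed_sum hcompleted).add hrunning
  simpa only [MassLLN.gradualSum, div_mul_eq_mul_div, add_zero] using hsum

theorem theorem2p3 {Ω : Type*} [MeasurableSpace Ω] (P : Measure Ω) [IsProbabilityMeasure P]
    (X : ℕ → ℝ → Ω → ℝ)
    (hX : MassLLN.IsIndependentFamily P X)
    (hC : MassLLN.Centered P X)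
    (hS1 : MassLLN.PolynomialDecay P X)
    (hS2 : MassLLN.StochasticDomination P X)
    (hS3 : MassLLN.SlowIncrementGrowth P X)
    (m : ℕ → ℝ) (hm : MassLLN.IsDivergentMass m) :
    ∀ᵐ ω ∂P, Tendsto (fun t : ℝ => MassLLN.gradualSum X m t ω) atTop (𝓝 0) :=
  theorem2p3_general P X hX hC hS1 (hS2.tendstoInMeasure_mul hX hC) hS3 m hm
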